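/- Theorem (Cosmological Theorem). Let $A=\{1,2,3,d\}$, where $d$ is a single formal symbol (representing the integers $\ge 4$), and let $W\subset A^*$ be the set of finite words over $A$ that do not contain four consecutive equal symbols. The audioactive (look-and-say) derivation $C:W\to W$ replaces each maximal run of $k\in\{1,2,3\}$ copies of a symbol $a$ by the two symbols $k\,a$ (and $C(\varepsilon)=\varepsilon$ for the empty word). A word $x\in W$ \emph{splits} into words $u_1,\dots,u_r$ ($r\ge 0$) if $C^k(x)=C^k(u_1)\cdots C^k(u_r)$ for all $k\ge 0$; the $u_i$ are then called splitting factors of $x$. A nonempty word of $W$ is an \emph{atom} if it has only one nonempty splitting factor (namely itself). Let $E$ be the set consisting of the following 92 words (the common elements, listed in the order of their atomic numbers): 22, 13112221133211322112211213322112, 312211322212221121123222112, 111312211312113221133211322112211213322112, 1321132122211322212221121123222112, 3113112211322112211213322112, 111312212221121123222112, 132112211213322112, 31121123222112, 111213322112, 123222112, 3113322112, 1113222112, 1322112, 311311222112, 1113122112, 132112, 3112, 1112, 12, 3113112221133112, 11131221131112, 13211312, 31132, 111311222112, 13122112, 32112, 11133112, 131112, 312, 13221133122211332, 31131122211311122113222,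 11131221131211322113322112, 13211321222113222112, 3113112211322112, 11131221222112, 1321122112, 3112112, 1112133, 12322211331222113112211, 1113122113322113111221131221, 13211322211312113211, 311322113212221, 132211331222113112211, 311311222113111221131221, 111312211312113211, 132113212221, 3113112211, 11131221, 13211, 3112221, 1322113312211, 311311222113111221, 11131221131211, 13211321, 311311, 11131, 1321133112, 31131112, 111312, 132, 311332, 1113222, 13221133112, 3113112221131112, 111312211312, 1321132, 311311222, 11131221133112, 1321131112, 311312, 11132, 13112221133211322112211213322113, 312211322212221121123222113, 111312211312113221133211322112211213322113, 1321132122211322212221121123222113, 3113112211322112211213322113, 111312212221121123222113, 132112211213322113, 31121123222113, 111213322113, 123222113, 3113322113, 1113222113, 1322113, 311311222113, 1113122113, 132113, 3113, 1113, 13, 3; together with the two words (the transuranic elements) 1311222113321132211221121332211d, 31221132221222112112322211d. Then $E$ is a set of 94 atoms, and for every word $x\in W$ and every integer $n\ge 24$, the $n$-th audioactive derivation $C^n(x)$ splits into atoms that belong to $E$. -/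

import Mathlib

namespace Audioactive

/-- The alphabet `{1, 2, 3, d}`; `d` is a single symbol that represents the integers at least four. -/
inductive Symb where
  | one | two | three | d
  deriving DecidableEq

/-- The symbol that writes down a (positive) count: `1`, `2`, `3`, and `d` from four on.
On words without four consecutive equal symbols only the first three cases occur. -/
def countSym : ℕ → Symb
  | 1 => .one
  | 2 => .two
  | 3 => .three
  | _ => .d

/-- The decomposition of a word into maximal runs of equal symbols, each given by its length and
its symbol. -/
def runs : List Symb → List (ℕ × Symb)
  | [] => []
  | a :: x =>
    match runs x with
    | [] => [(1, a)]
    | (n, b) :: r => if a = b then (n + 1, b) :: r else (1, a) :: (n, b) :: r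

/-- The audioactive (look-and-say) derivation: a maximal run of `n` copies of `a` becomes the two
symbols `n a`. -/
def C (x : List Symb) : List Symb :=
  (runs x).flatMap fun p => [countSym p.1, p.2]

/-- The words without four consecutive equal symbols. -/
def WDayOne : Set (List Symb) :=
  {x | ∀ a, ¬ List.replicate 4 a <:+: x}

/-- `x` splits into the words `u₁, …, uᵣ`: every iterated derivation of `x` is the concatenation of
the iterated derivations of the `uᵢ`. -/
def SplitsInto (x : List Symb) (us : List (List Symb)) : Prop :=
  ∀ n : ℕ, C^[n] x = (us.map C^[n]).flatten

/-- `u` is one of the words of some splitting of `x`. -/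
def IsSplittingFactor (u x : List Symb) : Prop :=
  ∃ us, SplitsInto x us ∧ u ∈ us

/-- An atom is a nonempty word with a single nonempty splitting factor. -/
def IsAtom (x : List Symb) : Prop :=
  x ≠ [] ∧ ∃! u, u ≠ [] ∧ IsSplittingFactor u x

/-- The word over `{1, 2, 3}` with the given decimal digits. -/
def word (n : ℕ) : List Symb :=
  ((Nat.digits 10 n).map countSym).reverse

section

open Symb (d)

/-- The 92 common elements, hydrogen to uranium, in the order of the atomic numbers. -/
def commonElements : List (List Symb) :=
  [word 22, word 13112221133211322112211213322112, word 312211322212221121123222112,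
   word 111312211312113221133211322112211213322112, word 1321132122211322212221121123222112,
   word 3113112211322112211213322112, word 111312212221121123222112, word 132112211213322112,
   word 31121123222112, word 111213322112, word 123222112, word 3113322112, word 1113222112,
   word 1322112, word 311311222112, word 1113122112, word 132112, word 3112, word 1112, word 12,
   word 3113112221133112, word 11131221131112, word 13211312, word 31132, word 111311222112,
   word 13122112, word 32112, word 11133112, word 131112, word 312, word 13221133122211332,
   word 31131122211311122113222, word 11131221131211322113322112, word 13211321222113222112,
   word 3113112211322112, word 11131221222112, word 1321122112, word 3112112, word 1112133,
   word 12322211331222113112211, word 1113122113322113111221131221, word 13211322211312113211,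
   word 311322113212221, word 132211331222113112211, word 311311222113111221131221,
   word 111312211312113211, word 132113212221, word 3113112211, word 11131221, word 13211,
   word 3112221, word 1322113312211, word 311311222113111221, word 11131221131211, word 13211321,
   word 311311, word 11131, word 1321133112, word 31131112, word 111312, word 132, word 311332,
   word 1113222, word 13221133112, word 3113112221131112, word 111312211312, word 1321132,
   word 311311222, word 11131221133112, word 1321131112, word 311312, word 11132,
   word 13112221133211322112211213322113, word 312211322212221121123222113,
   word 111312211312113221133211322112211213322113, word 1321132122211322212221121123222113,
   word 3113112211322112211213322113, word 111312212221121123222113, word 132112211213322113,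
   word 31121123222113, word 111213322113, word 123222113, word 3113322113, word 1113222113,
   word 1322113, word 311311222113, word 1113122113, word 132113, word 3113, word 1113, word 13,
   word 3]

/-- The two transuranic elements, neptunium and plutonium. -/
def transuranicElements : List (List Symb) :=
  [word 1311222113321132211221121332211 ++ [d], word 31221132221222112112322211 ++ [d]]

end

/-- The set of all common and transuranic elements. -/
def elements : Finset (List Symb) :=
  (commonElements ++ transuranicElements).toFinset

end Audioactive

/-! The derivation reads runs and keeps the last symbol of a word. Hence `p ++ q` splits into `p`
and `q` as soon as no iterated derivation of `q` begins with the last symbol of `p`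
(`iterate_C_append`). A bounded beginning of `q` can guarantee this: `AvoidsTwo` describes
beginnings that never lead to an initial `2`; the block `22` in front of such a word stays there
forever; an initial `d` never arises from a shorter first run. The resulting test `cuts` needs only
the finite summary `headCode`. It is used only as a sufficient condition for splitting.

Read from right to left, deriving and cutting are finite-state transformations: from a machine for a
language, `Machine.lift` makes one that accepts only words whose derived factors all lie in that
language (`accepts_of_accepts_lift`). Statements about the infinitely many words of `W` thus become
finite reachability searches. One search shows that the factors of once derived words are accepted
by a stored automaton. Two more pass from this automaton to stored automata for the second and third
derivation. The last shows that after eight further derivations every factor is one of the 94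
elements or of a finite list of isotopes. The tables are certificates: the searches verify all that
is needed of them.

Each isotope decays into elements within 13 derivations, and the factors of derived elements are
elements (`split_C_elements`), so all `n ≥ 24 = 11 + 13` are covered.

That the elements are atoms is shown independently of `cuts`: the derivations of the leftmost
nonempty factor remain prefixes of those of the element, and for each nonempty proper prefix this
fails after a few derivations. -/

namespace Audioactive

/-! ### Runs and the derivation -/

/-- The word that reads a list of runs aloud. -/
def say (rs : List (ℕ × Symb)) : List Symb :=
  rs.flatMap fun p => [countSym p.1, p.2]

@[simp] theorem say_nil : say [] = [] := rfl

@[simp] theorem say_cons (k : ℕ) (a : Symb) (rs : List (ℕ × Symb)) :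
    say ((k, a) :: rs) = countSym k :: a :: say rs := rfl

theorem say_append (rs ts : List (ℕ × Symb)) : say (rs ++ ts) = say rs ++ say ts := by
  simp [say]

theorem C_eq_say (x : List Symb) : C x = say (runs x) := rfl

@[simp] theorem runs_nil : runs [] = [] := rfl

theorem runs_cons_of_nil {a : Symb} {x : List Symb} (h : runs x = []) :
    runs (a :: x) = [(1, a)] := by
  simp [runs, h]

theorem runs_cons_same {a : Symb} {x : List Symb} {n : ℕ} {r : List (ℕ × Symb)}
    (h : runs x = (n, a) :: r) : runs (a :: x) = (n + 1, a) :: r := by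
  simp [runs, h]

theorem runs_cons_diff {a b : Symb} {x : List Symb} {n : ℕ} {r : List (ℕ × Symb)}
    (h : runs x = (n, b) :: r) (hab : a ≠ b) : runs (a :: x) = (1, a) :: (n, b) :: r := by
  simp [runs, h, hab]

theorem head?_runs (x : List Symb) : (runs x).head?.map Prod.snd = x.head? := by
  cases x with
  | nil => rfl
  | cons a x =>
    rcases h : runs x with _ | ⟨⟨n, b⟩, r⟩
    · simp [runs_cons_of_nil h]
    · by_cases hab : a = b
      · subst hab; simp [runs_cons_same h]
      · simp [runs_cons_diff h hab]

theorem runs_eq_nil {x : List Symb} : runs x = [] ↔ x = [] := by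
  constructor
  · intro h
    have := head?_runs x
    rw [h] at this
    simpa using this.symm
  · rintro rfl; rfl

/-- Prepending a letter different from the first one opens a new run. -/
theorem runs_cons_of_head?_ne {a : Symb} {x : List Symb} (h : x.head? ≠ some a) :
    runs (a :: x) = (1, a) :: runs x := by
  rcases hr : runs x with _ | ⟨⟨n, b⟩, r⟩
  · exact runs_cons_of_nil hr
  · refine runs_cons_diff hr ?_
    rintro rfl
    have := head?_runs x
    rw [hr] at this
    exact h this.symm

theorem runs_pos {x : List Symb} {n : ℕ} {a : Symb} {r : List (ℕ × Symb)}
    (h : runs x = (n, a) :: r) : 1 ≤ n := by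
  cases x with
  | nil => simp at h
  | cons b x =>
    rcases hr : runs x with _ | ⟨⟨m, c⟩, t⟩
    · rw [runs_cons_of_nil hr] at h; simp_all
    · by_cases hbc : b = c
      · subst hbc; rw [runs_cons_same hr] at h; simp at h; omega
      · rw [runs_cons_diff hr hbc] at h; simp at h; omega

/-- Consecutive runs carry different symbols. -/
def Alternating (rs : List (ℕ × Symb)) : Prop :=
  rs.IsChain fun p q => p.2 ≠ q.2

theorem alternating_runs (x : List Symb) : Alternating (runs x) := by
  induction x with
  | nil => exact List.IsChain.nil
  | cons a x ih =>
    rcases h : runs x with _ | ⟨⟨n, b⟩, r⟩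
    · rw [runs_cons_of_nil h]; exact List.IsChain.singleton _
    · rw [h] at ih
      by_cases hab : a = b
      · subst hab
        rw [runs_cons_same h]
        cases r with
        | nil => exact List.IsChain.singleton _
        | cons q r =>
          simp only [Alternating, List.isChain_cons_cons] at ih ⊢
          exact ih
      · rw [runs_cons_diff h hab]
        exact List.isChain_cons_cons.2 ⟨hab, ih⟩

/-- Runs of a concatenation whose parts do not merge. -/
theorem runs_append {p q : List Symb} (h : ∀ a ∈ p.getLast?, q.head? ≠ some a) :
    runs (p ++ q) = runs p ++ runs q := by
  induction p with
  | nil => rfl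
  | cons a p ih =>
    cases p with
    | nil =>
      simpa [runs] using runs_cons_of_head?_ne (x := q) (h a (by simp))
    | cons b p =>
      have ih := ih (by simpa using h)
      rcases hr : runs (b :: p) with _ | ⟨⟨n, c⟩, r⟩
      · simp [runs_eq_nil] at hr
      · rw [hr, List.cons_append] at ih
        by_cases hac : a = c
        · subst hac
          rw [List.cons_append, List.cons_append, runs_cons_same ih, runs_cons_same hr]; rfl
        · rw [List.cons_append, List.cons_append, runs_cons_diff ih hac, runs_cons_diff hr hac]; rfl

theorem C_append {p q : List Symb} (h : ∀ a ∈ p.getLast?, q.head? ≠ some a) :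
    C (p ++ q) = C p ++ C q := by
  rw [C_eq_say, runs_append h, say_append]; rfl

@[simp] theorem C_nil : C [] = [] := rfl

theorem C_eq_nil {x : List Symb} : C x = [] ↔ x = [] := by
  constructor
  · intro h
    rcases hr : runs x with _ | ⟨⟨n, b⟩, r⟩
    · exact runs_eq_nil.1 hr
    · simp [C_eq_say, hr] at h
  · rintro rfl; rfl

@[simp] theorem iterate_C_nil (n : ℕ) : C^[n] [] = [] :=
  Function.iterate_fixed C_nil n

theorem iterate_C_eq_nil {n : ℕ} {x : List Symb} : C^[n] x = [] ↔ x = [] := by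
  induction n generalizing x with
  | zero => rfl
  | succ n ih => rw [Function.iterate_succ_apply, ih, C_eq_nil]

theorem getLast?_say (rs : List (ℕ × Symb)) :
    (say rs).getLast? = rs.getLast?.map Prod.snd := by
  induction rs with
  | nil => rfl
  | cons p rs ih =>
    obtain ⟨k, a⟩ := p
    cases rs with
    | nil => rfl
    | cons q rs =>
      obtain ⟨j, b⟩ := q
      simpa [List.getLast?_cons_cons] using ih

theorem getLast?_runs (x : List Symb) : (runs x).getLast?.map Prod.snd = x.getLast? := by
  induction x with
  | nil => rfl
  | cons a x ih =>
    rcases h : runs x with _ | ⟨⟨n, b⟩, r⟩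
    · rw [runs_cons_of_nil h, runs_eq_nil.1 h]; rfl
    · have hx : x ≠ [] := by rintro rfl; simp at h
      obtain ⟨c, y, rfl⟩ := List.exists_cons_of_ne_nil hx
      rw [List.getLast?_cons_cons, ← ih, h]
      by_cases hab : a = b
      · subst hab
        rw [runs_cons_same h]
        cases r <;> simp [List.getLast?_cons_cons]
      · rw [runs_cons_diff h hab, List.getLast?_cons_cons]

/-- The derivation keeps the last symbol. -/
theorem getLast?_C (x : List Symb) : (C x).getLast? = x.getLast? := by
  rw [C_eq_say, getLast?_say, getLast?_runs]

theorem getLast?_iterate_C (n : ℕ) (x : List Symb) : (C^[n] x).getLast? = x.getLast? := by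
  induction n generalizing x with
  | zero => rfl
  | succ n ih => rw [Function.iterate_succ_apply, ih, getLast?_C]

/-- The last symbol of `p` survives every derivation, so the same symbol has to be avoided at each
stage. -/
theorem iterate_C_append {p q : List Symb}
    (h : ∀ n, ∀ a ∈ p.getLast?, (C^[n] q).head? ≠ some a) (n : ℕ) :
    C^[n] (p ++ q) = C^[n] p ++ C^[n] q := by
  induction n with
  | zero => rfl
  | succ n ih =>
    simp only [Function.iterate_succ_apply', ih]
    refine C_append fun a ha => h n a ?_
    rwa [getLast?_iterate_C] at ha

/-! ### First symbols of the iterated derivations -/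

/-- The beginnings of words, given by their runs, for which no iterated derivation starts
with `2`. -/
def AvoidsTwo : List (ℕ × Symb) → Bool
  | [] => true
  | (k, .one) :: rs => k == 3 || (k == 1 && rs.head?.any fun p => p.1 == 1)
  | (_, .two) :: _ => false
  | (k, .three) :: rs => k == 1 && rs.head?.all fun p => p.1 != 3
  | (k, .d) :: rs => k == 1 && rs.head?.all fun p => decide (p.1 < 4)

@[simp] theorem countSym_one : countSym 1 = .one := rfl

@[simp] theorem countSym_three : countSym 3 = .three := rfl

theorem countSym_eq_d {k : ℕ} : countSym k = .d ↔ k = 0 ∨ 4 ≤ k := by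
  rcases k with _ | _ | _ | _ | k <;> simp [countSym]

theorem countSym_eq_three {k : ℕ} : countSym k = .three ↔ k = 3 := by
  rcases k with _ | _ | _ | _ | k <;> simp [countSym]

/-- The admissible beginnings are carried into each other. Three `1`s yield `31`; a single `1`
before a run of length one yields `111`; a single `3` or `d` yields `13` or `1d`, where the
condition on the next run keeps the next count from lengthening the run of `3` or `d`. -/
theorem avoidsTwo_runs_say {rs : List (ℕ × Symb)} (hpos : ∀ p ∈ rs, 1 ≤ p.1)
    (halt : Alternating rs) (h : AvoidsTwo rs = true) : AvoidsTwo (runs (say rs)) = true := by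
  rcases rs with _ | ⟨⟨k, a⟩, _ | ⟨⟨j, b⟩, rs⟩⟩
  · rfl
  · cases a <;> simp [AvoidsTwo] at h <;> subst h <;> decide
  · simp only [Alternating, List.isChain_cons_cons] at halt
    have hj : 1 ≤ j := hpos (j, b) (by simp)
    obtain ⟨hab, -⟩ := halt
    cases a with
    | two => simp [AvoidsTwo] at h
    | one =>
      have hb : (b :: say rs).head? ≠ some Symb.one := by simpa using Ne.symm hab
      simp only [AvoidsTwo, Bool.or_eq_true, beq_iff_eq, Bool.and_eq_true, List.head?_cons,
        Option.any_some] at h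
      rcases h with rfl | ⟨rfl, rfl⟩
      · simp only [say_cons, countSym_three]
        rw [runs_cons_of_head?_ne (by simp)]
        by_cases h1 : countSym j = .one
        · rw [h1]
          simp [runs_cons_same (runs_cons_of_head?_ne hb), AvoidsTwo]
        · rw [runs_cons_of_head?_ne (by simpa using h1)]
          simp [AvoidsTwo]
      · simp only [say_cons, countSym_one]
        rw [runs_cons_same (runs_cons_same (runs_cons_of_head?_ne hb))]
        simp [AvoidsTwo]
    | three =>
      simp [AvoidsTwo] at h
      obtain ⟨rfl, h⟩ := h
      have : countSym j ≠ .three := by rwa [Ne, countSym_eq_three]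
      simp only [say_cons, countSym_one]
      rw [runs_cons_of_head?_ne (by simp), runs_cons_of_head?_ne (by simpa using this)]
      simp [AvoidsTwo]
    | d =>
      simp [AvoidsTwo] at h
      obtain ⟨rfl, h⟩ := h
      have : countSym j ≠ .d := by rw [Ne, countSym_eq_d]; omega
      simp only [say_cons, countSym_one]
      rw [runs_cons_of_head?_ne (by simp), runs_cons_of_head?_ne (by simpa using this)]
      simp [AvoidsTwo]

theorem one_le_of_mem_runs {x : List Symb} : ∀ p ∈ runs x, 1 ≤ p.1 := by
  induction x with
  | nil => simp
  | cons a x ih =>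
    rcases h : runs x with _ | ⟨⟨n, b⟩, r⟩
    · simp [runs_cons_of_nil h]
    · rw [h] at ih
      by_cases hab : a = b
      · subst hab
        rw [runs_cons_same h]
        simp only [List.mem_cons, forall_eq_or_imp] at ih ⊢
        exact ⟨by omega, ih.2⟩
      · rw [runs_cons_diff h hab]
        simpa using ih

theorem avoidsTwo_C {x : List Symb} (h : AvoidsTwo (runs x) = true) :
    AvoidsTwo (runs (C x)) = true :=
  avoidsTwo_runs_say one_le_of_mem_runs (alternating_runs x) h

theorem head?_ne_of_invariant {a : Symb} (P : List Symb → Prop) (hC : ∀ x, P x → P (C x))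
    (hP : ∀ x, P x → x.head? ≠ some a) {x : List Symb} (hx : P x) (n : ℕ) :
    (C^[n] x).head? ≠ some a := by
  induction n generalizing x with
  | zero => exact hP x hx
  | succ n ih => exact ih (hC x hx)

theorem head?_ne_two_of_avoidsTwo {x : List Symb} (h : AvoidsTwo (runs x) = true) :
    x.head? ≠ some .two := by
  rw [← head?_runs]
  generalize runs x = rs at h
  rcases rs with _ | ⟨⟨k, a⟩, r⟩
  · simp
  · cases a <;> simp_all [AvoidsTwo]

theorem iterate_head?_ne_two {x : List Symb} (h : AvoidsTwo (runs x) = true) (n : ℕ) :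
    (C^[n] x).head? ≠ some .two :=
  head?_ne_of_invariant (fun x => AvoidsTwo (runs x) = true) (fun _ => avoidsTwo_C)
    (fun _ => head?_ne_two_of_avoidsTwo) h n

/-- The word `22` is fixed by the derivation, and what follows never starts with a `2` that could
enlarge this run. -/
theorem iterate_head?_eq_two {x : List Symb} {rs : List (ℕ × Symb)}
    (hx : runs x = (2, .two) :: rs) (h : AvoidsTwo rs = true) {a : Symb} (ha : a ≠ .two) (n : ℕ) :
    (C^[n] x).head? ≠ some a := by
  refine head?_ne_of_invariant
    (fun x => ∃ rs, runs x = (2, .two) :: rs ∧ AvoidsTwo rs = true) ?_ ?_ ⟨rs, hx, h⟩ n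
  · rintro x ⟨rs, hx, h⟩
    have hrs := alternating_runs x
    have hpos := one_le_of_mem_runs (x := x)
    rw [hx] at hrs hpos
    have h' := avoidsTwo_runs_say (rs := rs) (fun p hp => hpos p (List.mem_cons_of_mem _ hp)) hrs.tail h
    refine ⟨runs (say rs), ?_, h'⟩
    rw [C_eq_say, hx, say_cons]
    exact runs_cons_same (runs_cons_of_head?_ne (head?_ne_two_of_avoidsTwo h'))
  · rintro x ⟨rs, hx, -⟩
    rw [← head?_runs, hx]
    simpa using ha.symm

/-- The first run of a derived word has at most three symbols. -/
theorem first_run_C_lt_four {x : List Symb} {k : ℕ} {a : Symb} {r : List (ℕ × Symb)}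
    (h : runs (C x) = (k, a) :: r) : k < 4 := by
  have halt := alternating_runs x
  rw [C_eq_say] at h
  generalize runs x = rs at h halt
  rcases rs with _ | ⟨⟨j, b⟩, _ | ⟨⟨i, c⟩, rs⟩⟩
  · simp at h
  · by_cases hb : countSym j = b
    · simp [hb, runs] at h; omega
    · simp [hb, runs] at h; omega
  · simp only [Alternating, List.isChain_cons_cons] at halt
    simp only [say_cons] at h
    -- The derived word begins with count, `b`, count, `c`; since `b ≠ c`, its first four symbols
    -- are not all equal.
    by_cases hb : countSym j = b
    · rw [hb] at h
      have hc : (c :: say rs).head? ≠ some b := by simpa using Ne.symm halt.1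
      by_cases hi : countSym i = b
      · rw [hi, runs_cons_same (runs_cons_same (runs_cons_of_head?_ne hc))] at h
        simp at h; omega
      · rw [runs_cons_same (runs_cons_of_head?_ne (by simpa using hi))] at h
        simp at h; omega
    · rw [runs_cons_of_head?_ne (by simpa using Ne.symm hb)] at h
      simp at h; omega

/-- An initial `d` could only be the count of a first run of length at least four, and no derived
word begins with such a run. -/
theorem iterate_head?_ne_d {x : List Symb} (hx : x.head? ≠ some .d)
    (h : ∀ p ∈ (runs x).head?, p.1 < 4) (n : ℕ) : (C^[n] x).head? ≠ some .d := by
  refine head?_ne_of_invariant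
    (fun x => x.head? ≠ some .d ∧ ∀ p ∈ (runs x).head?, p.1 < 4) ?_ (fun _ h => h.1) ⟨hx, h⟩ n
  rintro x ⟨-, h⟩
  refine ⟨?_, fun p hp => ?_⟩
  · rcases hr : runs x with _ | ⟨⟨k, a⟩, r⟩
    · simp [C_eq_say, hr]
    · have h1 := runs_pos hr
      have h2 : k < 4 := h (k, a) (by simp [hr])
      simp only [C_eq_say, hr, say_cons, List.head?_cons, ne_eq, Option.some.injEq, countSym_eq_d]
      omega
  · rcases hr : runs (C x) with _ | ⟨⟨k, a⟩, r⟩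
    · simp [hr] at hp
    · rw [hr] at hp
      simp at hp
      subst hp
      exact first_run_C_lt_four hr

/-! ### Splitting a word from right to left -/

/-- The digit of a symbol. -/
def Symb.digit : Symb → ℕ
  | .one => 1
  | .two => 2
  | .three => 3
  | .d => 4

/-- The machines use the bare functions `Nat.mod`, `Nat.div` and so on, which the kernel evaluates
on literals without unfolding instances; these equations translate back for `omega` and `simp`. -/
theorem natMod_eq (m n : ℕ) : Nat.mod m n = m % n := rfl

theorem natDiv_eq (m n : ℕ) : Nat.div m n = m / n := rfl

theorem natAdd_eq (m n : ℕ) : Nat.add m n = m + n := rfl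

theorem natMul_eq (m n : ℕ) : Nat.mul m n = m * n := rfl

/-- A numerical summary of the beginning of a word: the digit of the first symbol, the length of
the first run (truncated at four), and one bit that tells whether the word (or what follows the
first run, if that is a run of `2`) avoids `2`. -/
def headCode : List (ℕ × Symb) → ℕ
  | [] => 0
  | (k, .two) :: rs => 2 + 8 * min k 4 + 64 * (AvoidsTwo rs).toNat
  | (k, a) :: rs => a.digit + 8 * min k 4 + 64 * (AvoidsTwo ((k, a) :: rs)).toNat

/-- The summary of a word after a symbol has been prepended. -/
def extendHead (h a : ℕ) : ℕ :=
  bif Nat.beq (Nat.mod h 8) a then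
    bif Nat.beq (Nat.mod (Nat.div h 8) 8) 4 then h
    else bif Nat.beq a 2 then Nat.add h 8
    -- `89 = 1 + 8 * 3 + 64`: a run of three `1`s avoids `2` whatever follows.
    else bif Nat.beq a 1 && Nat.beq (Nat.mod (Nat.div h 8) 8) 2 then 89
    else Nat.add a (Nat.mul 8 (Nat.succ (Nat.mod (Nat.div h 8) 8)))
  else
    bif bif Nat.beq a 1 then Nat.beq (Nat.mod (Nat.div h 8) 8) 1
      else bif Nat.beq a 2 then Nat.beq h 0 || Nat.beq (Nat.div h 64) 1
      else bif Nat.beq a 3 then !Nat.beq (Nat.mod (Nat.div h 8) 8) 3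
      else !Nat.beq (Nat.mod (Nat.div h 8) 8) 4
    -- A new run has length one, which contributes `8`; the bit adds `64`.
    then Nat.add a 72 else Nat.add a 8

/-- Whether a symbol never merges with a word whose summary is `h`. -/
def cuts (a h : ℕ) : Bool :=
  bif Nat.beq a 2 then Nat.beq (Nat.div h 64) 1 && !Nat.beq (Nat.mod h 8) 2
  else bif Nat.beq a 4 then
    -- Summary `0` belongs to the empty word; excluding it prevents a cut at the end of a word.
    !Nat.beq h 0 && (!Nat.beq (Nat.mod h 8) 4 && !Nat.beq (Nat.mod (Nat.div h 8) 8) 4)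
  -- `82 = 2 + 8 * 2 + 64`: exactly two `2`s, followed by a word that avoids `2`.
  else Nat.beq h 82

theorem avoidsTwo_cons_one (k : ℕ) (rs : List (ℕ × Symb)) :
    AvoidsTwo ((k, .one) :: rs) = (k == 3 || (k == 1 && rs.head?.any fun p => p.1 == 1)) := rfl

theorem avoidsTwo_cons_three (k : ℕ) (rs : List (ℕ × Symb)) :
    AvoidsTwo ((k, .three) :: rs) = (k == 1 && rs.head?.all fun p => p.1 != 3) := rfl

theorem avoidsTwo_cons_d (k : ℕ) (rs : List (ℕ × Symb)) :
    AvoidsTwo ((k, .d) :: rs) = (k == 1 && rs.head?.all fun p => decide (p.1 < 4)) := rfl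

/-- Lengths from four on are equivalent, and the remaining runs enter only through Boolean values.
Once these are generalized, a finite check is left. -/
theorem headCode_runs_cons (a : Symb) (x : List Symb) :
    headCode (runs (a :: x)) = extendHead (headCode (runs x)) a.digit := by
  rcases h : runs x with _ | ⟨⟨k, b⟩, rs⟩
  · rw [runs_cons_of_nil h]
    cases a <;> rfl
  · have hmin (j : ℕ) : min (j + 4) 4 = 4 := by omega
    obtain rfl | rfl | rfl | ⟨j, rfl⟩ : k = 1 ∨ k = 2 ∨ k = 3 ∨ ∃ j, k = j + 4 := by
      have hk := runs_pos h
      rcases k with _ | _ | _ | _ | j <;> simp at hk ⊢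
    all_goals
      by_cases hab : a = b
      · subst hab
        rw [runs_cons_same h]
        cases a <;> simp only [headCode, avoidsTwo_cons_one, avoidsTwo_cons_three,
          avoidsTwo_cons_d, hmin] <;>
        generalize AvoidsTwo rs = u <;> generalize rs.head?.any _ = v <;>
        generalize rs.head?.all (fun p => p.1 != 3) = w <;>
        generalize rs.head?.all (fun p => decide (p.1 < 4)) = z <;>
        simp <;> decide +revert
      · rw [runs_cons_diff h hab]
        cases a <;> cases b <;> first | exact absurd rfl hab | skip
        all_goals
          simp only [headCode, avoidsTwo_cons_one, avoidsTwo_cons_three, avoidsTwo_cons_d, hmin,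
            List.head?_cons, Option.any_some, Option.all_some]
          generalize AvoidsTwo rs = u
          generalize rs.head?.any _ = v
          generalize rs.head?.all (fun p => p.1 != 3) = w
          generalize rs.head?.all (fun p => decide (p.1 < 4)) = z
          simp
          decide +revert

theorem headCode_lt (rs : List (ℕ × Symb)) : headCode rs < 128 := by
  have hb (b : Bool) : b.toNat ≤ 1 := Bool.toNat_le b
  rcases rs with _ | ⟨⟨k, a⟩, rs⟩
  · simp [headCode]
  · cases a <;> simp only [headCode, Symb.digit]
    · have := hb (AvoidsTwo ((k, .one) :: rs)); omega
    · have := hb (AvoidsTwo rs); omega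
    · have := hb (AvoidsTwo ((k, .three) :: rs)); omega
    · have := hb (AvoidsTwo ((k, .d) :: rs)); omega

theorem headCode_mod_eight {k : ℕ} {a : Symb} {rs : List (ℕ × Symb)} :
    headCode ((k, a) :: rs) % 8 = a.digit := by
  cases a <;> simp only [headCode, Symb.digit] <;> omega

theorem headCode_div_eight_mod_eight {k : ℕ} {a : Symb} {rs : List (ℕ × Symb)} :
    headCode ((k, a) :: rs) / 8 % 8 = min k 4 := by
  cases a <;> simp only [headCode, Symb.digit] <;> omega

theorem Symb.digit_injective : Function.Injective Symb.digit := by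
  intro a b h
  cases a <;> cases b <;> simp_all [Symb.digit]

theorem Symb.digit_pos (a : Symb) : 0 < a.digit := by cases a <;> decide

/-- A cut is never bridged by the derivation. -/
theorem head?_iterate_C_ne_of_cuts {a : Symb} {x : List Symb}
    (h : cuts a.digit (headCode (runs x)) = true) (n : ℕ) : (C^[n] x).head? ≠ some a := by
  rcases hr : runs x with _ | ⟨⟨k, b⟩, rs⟩
  · rw [runs_eq_nil.1 hr]; simp
  · have h22 (h : headCode (runs x) = 82) (ha : a ≠ .two) : (C^[n] x).head? ≠ some a := by
      have h1 := headCode_mod_eight (k := k) (a := b) (rs := rs)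
      have h2 := headCode_div_eight_mod_eight (k := k) (a := b) (rs := rs)
      rw [← hr, h] at h1 h2
      obtain rfl : b = .two := Symb.digit_injective h1.symm
      obtain rfl : k = 2 := by omega
      refine iterate_head?_eq_two hr ?_ ha n
      rw [hr] at h
      cases hA : AvoidsTwo rs
      · simp [headCode, hA] at h
      · rfl
    cases a with
    | one => exact h22 (by simpa [cuts, Symb.digit] using h) (by simp)
    | three => exact h22 (by simpa [cuts, Symb.digit] using h) (by simp)
    | two =>
      refine iterate_head?_ne_two ?_ n
      rw [hr] at h ⊢
      simp only [Symb.digit, cuts, natMod_eq, natDiv_eq, headCode_mod_eight, Nat.beq_refl, cond_true,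
        Bool.and_eq_true, Nat.beq_eq] at h
      cases b with
      | two => simp at h
      | _ =>
        have h := h.1
        revert h
        simp only [headCode, Symb.digit]
        cases AvoidsTwo _
        · simp only [Bool.toNat_false]; omega
        · simp
    | d =>
      rw [hr] at h
      simp only [Symb.digit, cuts, natMod_eq, natDiv_eq, headCode_mod_eight,
        headCode_div_eight_mod_eight] at h
      refine iterate_head?_ne_d ?_ ?_ n
      · rw [← head?_runs, hr]
        rintro ⟨⟩
        simp at h
      · rw [hr]
        rintro p ⟨⟩
        by_contra hk
        rw [show min k 4 = 4 by omega] at h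
        simp at h

/-- The splitting of a word at its cuts, each factor preceded by its summary. -/
def splitAux : List Symb → List (ℕ × List Symb)
  | [] => []
  | a :: x =>
    match splitAux x with
    | [] => [(extendHead 0 a.digit, [a])]
    | (h, v) :: vs =>
      bif cuts a.digit h then (extendHead 0 a.digit, [a]) :: (h, v) :: vs
      else (extendHead h a.digit, a :: v) :: vs

/-- The splitting of a word at its cuts. -/
def split (x : List Symb) : List (List Symb) :=
  (splitAux x).map Prod.snd

@[simp] theorem split_nil : split [] = [] := rfl

theorem fst_of_mem_splitAux {x : List Symb} :
    ∀ p ∈ splitAux x, p.1 = headCode (runs p.2) := by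
  induction x with
  | nil => simp [splitAux]
  | cons a x ih =>
    have ha : extendHead 0 a.digit = headCode (runs [a]) := (headCode_runs_cons a []).symm
    rw [splitAux]
    generalize splitAux x = us at ih
    rcases us with _ | ⟨⟨h, v⟩, vs⟩
    · simpa using ha
    · simp only [List.mem_cons, forall_eq_or_imp] at ih
      dsimp only
      cases cuts a.digit h
      · simp only [cond_false, List.mem_cons, forall_eq_or_imp]
        exact ⟨by rw [headCode_runs_cons, ih.1], ih.2⟩
      · simp only [cond_true, List.mem_cons, forall_eq_or_imp]
        exact ⟨ha, ih⟩

theorem split_cons_of_nil {a : Symb} {x : List Symb} (h : split x = []) :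
    split (a :: x) = [[a]] := by
  have : splitAux x = [] := by simpa [split] using h
  simp [split, splitAux, this]

theorem split_cons_of_cons {a : Symb} {x v : List Symb} {vs : List (List Symb)}
    (h : split x = v :: vs) :
    split (a :: x) = bif cuts a.digit (headCode (runs v)) then [a] :: v :: vs
      else (a :: v) :: vs := by
  have hfst := fst_of_mem_splitAux (x := x)
  rw [split] at h ⊢
  rw [splitAux]
  rcases hs : splitAux x with _ | ⟨⟨k, w⟩, ws⟩
  · simp [hs] at h
  · rw [hs] at h hfst
    simp only [List.map_cons, List.cons.injEq] at h
    obtain ⟨rfl, rfl⟩ := h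
    have : k = headCode (runs w) := hfst (k, w) (by simp)
    subst this
    dsimp only
    cases cuts a.digit (headCode (runs w)) <;> simp

/-! ### Splittings -/

/-- Nonempty words that never merge with their right neighbours. -/
def Separated : List (List Symb) → Prop
  | [] => True
  | u :: us => u ≠ [] ∧ Separated us ∧
      ∀ n, ∀ a ∈ u.getLast?, (C^[n] us.flatten).head? ≠ some a

theorem Separated.splitsInto {us : List (List Symb)} (h : Separated us) :
    SplitsInto us.flatten us := by
  induction us with
  | nil => intro n; simp
  | cons u us ih =>
    intro n
    rw [List.flatten_cons, iterate_C_append h.2.2 n, ih h.2.1 n]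
    simp

theorem separated_split (x : List Symb) : Separated (split x) ∧ (split x).flatten = x := by
  induction x with
  | nil => exact ⟨trivial, rfl⟩
  | cons a x ih =>
    obtain ⟨ih, hx⟩ := ih
    rcases hs : split x with _ | ⟨v, vs⟩
    · rw [split_cons_of_nil hs]
      rw [hs] at hx
      subst hx
      simp [Separated]
    · rw [split_cons_of_cons hs]
      rw [hs] at ih hx
      cases hc : cuts a.digit (headCode (runs v))
      · simp only [cond_false]
        refine ⟨⟨by simp, ih.2.1, ?_⟩, by simp [← hx]⟩
        obtain ⟨b, w, rfl⟩ := List.exists_cons_of_ne_nil ih.1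
        simpa [List.getLast?_cons_cons] using ih.2.2
      · simp only [cond_true]
        refine ⟨⟨by simp, ih, ?_⟩, by simp [← hx]⟩
        intro n b hb
        obtain rfl : a = b := by simpa using hb
        -- The derivations of the nonempty word `v` are nonempty, so the first symbol of the whole
        -- comes from `v`, the only factor that the cut test inspects.
        rw [ih.splitsInto n, List.map_cons, List.flatten_cons, List.head?_append_of_ne_nil]
        · exact head?_iterate_C_ne_of_cuts hc n
        · rw [Ne, iterate_C_eq_nil]
          exact ih.1

theorem splitsInto_split (x : List Symb) : SplitsInto x (split x) := by
  obtain ⟨h, hx⟩ := separated_split x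
  have := h.splitsInto
  rwa [hx] at this

/-- The factors obtained from a word by `n` derivations with subsequent splittings. -/
def decay : ℕ → List Symb → List (List Symb)
  | 0, x => [x]
  | n + 1, x => (split (C x)).flatMap (decay n)

/-- Splittings compose: each factor may be derived and split further on its own. -/
theorem SplitsInto.flatMap {x : List Symb} {us : List (List Symb)} (h : SplitsInto x us) {n : ℕ}
    {f : List Symb → List (List Symb)} (hf : ∀ u ∈ us, SplitsInto (C^[n] u) (f u)) :
    SplitsInto (C^[n] x) (us.flatMap f) := by
  intro m
  rw [← Function.iterate_add_apply, h (m + n), List.flatMap_def, List.map_flatten,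
    List.map_map, List.flatten_flatten, List.map_map]
  congr 1
  refine List.map_congr_left fun u hu => ?_
  rw [Function.iterate_add_apply, hf u hu m]
  rfl

theorem splitsInto_decay (n : ℕ) (x : List Symb) : SplitsInto (C^[n] x) (decay n x) := by
  induction n generalizing x with
  | zero => intro m; simp [decay]
  | succ n ih => exact (splitsInto_split (C x)).flatMap fun u _ => ih u

theorem mem_decay_add {m n : ℕ} {x u : List Symb} :
    u ∈ decay (m + n) x ↔ ∃ v ∈ decay m x, u ∈ decay n v := by
  induction m generalizing x with
  | zero => simp [decay]
  | succ m ih =>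
    rw [Nat.succ_add]
    simp only [decay, List.mem_flatMap, ih]
    tauto

/-! ### Machines that read words from right to left -/

/-- A function call that evaluates its argument first. In kernel computations this bounds the size
of terms, and the values of functions at equal arguments are shared. -/
def strict {α : Type*} (n : ℕ) (f : ℕ → α) : α :=
  Nat.rec (f 0) (fun m _ => f (Nat.succ m)) n

@[simp] theorem strict_eq {α : Type*} (n : ℕ) (f : ℕ → α) : strict n f = f n := by
  cases n <;> rfl

/-- A partial deterministic machine that reads digits; its initial state is `0`, and a state
modulo `128` is meant to be the summary of the word read so far. -/
structure Machine where
  step : ℕ → ℕ → Option ℕ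
  ok : ℕ → Bool

namespace Machine

variable (M : Machine)

/-- The state after a word has been read from right to left. -/
def read : List Symb → Option ℕ
  | [] => some 0
  | a :: w => (read w).bind fun s => M.step s a.digit

/-- The machine reads the whole word and ends in a good state. -/
def Accepts (w : List Symb) : Prop :=
  ∃ s, M.read w = some s ∧ M.ok s = true

/-- The states contain the summaries of the words. -/
def Headed : Prop :=
  ∀ w s, M.read w = some s → s % 128 = headCode (runs w)

/-- A step that starts afresh at each cut, provided that the word before the cut is accepted. -/
def cutStep (s a : ℕ) : Option ℕ :=
  bif cuts a (Nat.mod s 128) then bif M.ok s then M.step 0 a else none else M.step s a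

/-- The state after a word has been read with a fresh start at each cut. -/
def cutRead : List Symb → Option ℕ
  | [] => some 0
  | a :: x => (cutRead x).bind fun s => M.cutStep s a.digit

variable {M}

/-- Reading goes leftwards, so the current state belongs to the leftmost, still growing factor `v`.
As `M` is headed, this state contains the summary on which `split` bases its decision. -/
theorem split_of_cutRead (hM : M.Headed) {x : List Symb} {s : ℕ} (h : M.cutRead x = some s) :
    x = [] ∧ s = 0 ∨
      ∃ v vs, split x = v :: vs ∧ M.read v = some s ∧ ∀ u ∈ vs, M.Accepts u := by
  induction x generalizing s with
  | nil => simp_all [cutRead]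
  | cons a x ih =>
    right
    obtain ⟨t, ht, hs⟩ := Option.bind_eq_some_iff.1 h
    obtain ⟨rfl, rfl⟩ | ⟨v, vs, hx, hv, hvs⟩ := ih ht
    · refine ⟨[a], [], rfl, ?_, by simp⟩
      have : cuts a.digit (0 % 128) = false := by cases a <;> rfl
      simpa [cutStep, this, read] using hs
    · rw [split_cons_of_cons hx, ← hM v t hv]
      rw [cutStep, natMod_eq] at hs
      cases hc : cuts a.digit (t % 128)
      · rw [hc] at hs
        refine ⟨a :: v, vs, rfl, ?_, hvs⟩
        simpa [read, hv] using hs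
      · rw [hc] at hs
        cases hok : M.ok t
        · simp [hok] at hs
        · refine ⟨[a], v :: vs, rfl, by simpa [read, hok] using hs, ?_⟩
          simpa using ⟨⟨t, hv, hok⟩, hvs⟩

theorem accepts_of_cutRead (hM : M.Headed) {x : List Symb} {s : ℕ} (h : M.cutRead x = some s)
    (hs : x = [] ∨ M.ok s = true) : ∀ u ∈ split x, M.Accepts u := by
  obtain ⟨rfl, rfl⟩ | ⟨v, vs, hx, hv, hvs⟩ := split_of_cutRead hM h
  · simp
  · rcases hs with rfl | hs
    · simp at hx
    · rw [hx]
      simpa using ⟨⟨s, hv, hs⟩, hvs⟩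

variable (M)

/-- Feed a completed run, given by the summary `h`, to the machine. -/
def emit (h m : ℕ) : Option ℕ :=
  strict m fun m => strict (Nat.mod h 8) fun a =>
    -- From right to left the symbol of the run comes before its count.
    (M.cutStep m a).bind fun m' => strict m' fun m' =>
      strict (Nat.mod (Nat.div h 8) 8) fun k => M.cutStep m' k

/-- The machine that reads a word and accepts it if `M` accepts all factors of the derived word:
it keeps a summary of the word and a state of `M`. -/
def lift : Machine where
  step s a := strict (Nat.mod s 128) fun h =>
    -- The leftmost run may still grow; it is fed to `M` only when a different symbol ends it.
    bif Nat.beq h 0 || Nat.beq (Nat.mod h 8) a then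
      some (Nat.add (extendHead h a) (Nat.mul 128 (Nat.div s 128)))
    else (M.emit h (Nat.div s 128)).bind fun m => some (Nat.add (extendHead h a) (Nat.mul 128 m))
  -- At the end of the word the pending leftmost run is still to be fed to `M`.
  ok s := strict (Nat.mod s 128) fun h =>
    match M.emit h (Nat.div s 128) with
    | none => false
    | some m => M.ok m

variable {M}

theorem digit_countSym {k : ℕ} (hk : 1 ≤ k) : (countSym k).digit = min k 4 := by
  rcases k with _ | _ | _ | _ | k
  · omega
  · rfl
  · rfl
  · rfl
  · simp [countSym, Symb.digit]

theorem cutRead_say_cons {k m : ℕ} {a : Symb} {rs : List (ℕ × Symb)} (hk : 1 ≤ k)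
    (h : M.cutRead (say rs) = some m) :
    M.cutRead (say ((k, a) :: rs)) = M.emit (headCode ((k, a) :: rs)) m := by
  simp [say_cons, cutRead, h, emit, natMod_eq, natDiv_eq, headCode_mod_eight, headCode_div_eight_mod_eight,
    digit_countSym hk]

/-- The `tail` reflects the pending run: it is recorded in the summary, and only the runs to its
right have been read aloud. -/
theorem lift_read {w : List Symb} {s : ℕ} (h : M.lift.read w = some s) :
    s % 128 = headCode (runs w) ∧ M.cutRead (say (runs w).tail) = some (s / 128) := by
  induction w generalizing s with
  | nil =>
    obtain rfl : 0 = s := by simpa [read] using h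
    exact ⟨rfl, rfl⟩
  | cons a w ih =>
    obtain ⟨t, ht, hs⟩ := Option.bind_eq_some_iff.1 h
    obtain ⟨ih1, ih2⟩ := ih ht
    have hlt := headCode_lt (runs (a :: w))
    rw [headCode_runs_cons, ← ih1] at hlt ⊢
    suffices ∃ m, s = extendHead (t % 128) a.digit + 128 * m ∧
        M.cutRead (say (runs (a :: w)).tail) = some m by
      obtain ⟨m, rfl, hm⟩ := this
      refine ⟨by omega, ?_⟩
      rw [hm]
      congr 1
      omega
    rw [lift] at hs
    simp only [strict_eq, natMod_eq, natDiv_eq, natAdd_eq, natMul_eq] at hs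
    rcases hr : runs w with _ | ⟨⟨k, b⟩, rs⟩
    · rw [hr] at ih1 ih2
      rw [ih1] at hs ⊢
      refine ⟨t / 128, ?_, ?_⟩
      · simpa [headCode, eq_comm] using hs
      · rw [runs_cons_of_nil hr]; exact ih2
    · rw [hr] at ih1 ih2
      rw [List.tail_cons] at ih2
      have hne : Nat.beq (t % 128) 0 = false := by
        rw [ih1, Bool.eq_false_iff, Ne, Nat.beq_eq]
        intro h0
        have := headCode_mod_eight (k := k) (a := b) (rs := rs)
        have := b.digit_pos
        omega
      have hb : t % 128 % 8 = b.digit := by rw [ih1, headCode_mod_eight]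
      rw [hne, hb, Bool.false_or] at hs
      by_cases hab : a = b
      · subst hab
        rw [Nat.beq_refl] at hs
        refine ⟨t / 128, by simpa [eq_comm] using hs, ?_⟩
        rw [runs_cons_same hr]
        exact ih2
      · have : Nat.beq b.digit a.digit = false := by
          rw [Bool.eq_false_iff, Ne, Nat.beq_eq]
          exact fun h => hab (Symb.digit_injective h.symm)
        rw [this, cond_false, Option.bind_eq_some_iff] at hs
        obtain ⟨m, hm, hs⟩ := hs
        refine ⟨m, by simpa [eq_comm] using hs, ?_⟩
        rw [runs_cons_diff hr hab, List.tail_cons, cutRead_say_cons (runs_pos hr) ih2, ← ih1, hm]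

theorem headed_lift : M.lift.Headed := fun _ _ h => (lift_read h).1

theorem accepts_of_accepts_lift (hM : M.Headed) {w : List Symb} (h : M.lift.Accepts w) :
    ∀ u ∈ split (C w), M.Accepts u := by
  obtain ⟨s, hs, hok⟩ := h
  obtain ⟨h1, h2⟩ := lift_read hs
  rcases hr : runs w with _ | ⟨⟨k, a⟩, rs⟩
  · simp [C_eq_say, hr]
  · rw [hr] at h1 h2
    rw [List.tail_cons] at h2
    simp only [lift, strict_eq, natMod_eq, natDiv_eq, h1] at hok
    cases hm : M.emit (headCode ((k, a) :: rs)) (s / 128) with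
    | none => simp [hm] at hok
    | some m =>
      rw [hm] at hok
      refine accepts_of_cutRead hM ?_ (Or.inr hok)
      rw [C_eq_say, hr, cutRead_say_cons (runs_pos hr) h2, hm]

theorem headed_iterate_lift (hM : M.Headed) : ∀ n, (lift^[n] M).Headed
  | 0 => hM
  | n + 1 => by rw [Function.iterate_succ_apply']; exact headed_lift

theorem accepts_of_mem_decay (hM : M.Headed) {n : ℕ} {w : List Symb}
    (h : (lift^[n] M).Accepts w) : ∀ u ∈ decay n w, M.Accepts u := by
  induction n generalizing w with
  | zero => simpa [decay] using h
  | succ n ih =>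
    rw [Function.iterate_succ_apply'] at h
    intro u hu
    obtain ⟨v, hv, hu⟩ := List.mem_flatMap.1 hu
    exact ih (accepts_of_accepts_lift (headed_iterate_lift hM n) h v hv) u hu

end Machine

/-! ### Exploration of the reachable states -/

/-- Binary search trees of natural numbers. -/
inductive Tree where
  | leaf
  | node (l : Tree) (k : ℕ) (r : Tree)

namespace Tree

/-- Whether a number is in a tree; written with the recursor for the sake of kernel computations. -/
noncomputable def mem (p : ℕ) (t : Tree) : Bool :=
  Tree.rec false (fun _ k _ l r => bif Nat.beq p k then true else bif Nat.ble p k then l else r) t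

/-- The tree with an additional number. -/
noncomputable def insert (p : ℕ) (t : Tree) : Tree :=
  Tree.rec (node leaf p leaf)
    (fun l k r l' r' => bif Nat.ble p k then node l' k r else node l k r') t

@[simp] theorem mem_leaf (p : ℕ) : leaf.mem p = false := rfl

theorem mem_node (p k : ℕ) (l r : Tree) : (node l k r).mem p =
    bif Nat.beq p k then true else bif Nat.ble p k then l.mem p else r.mem p := rfl

theorem insert_leaf (p : ℕ) : leaf.insert p = node leaf p leaf := rfl

theorem insert_node (p k : ℕ) (l r : Tree) : (node l k r).insert p =
    bif Nat.ble p k then node (l.insert p) k r else node l k (r.insert p) := rfl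

theorem mem_insert {p q : ℕ} {t : Tree} :
    (t.insert p).mem q = true ↔ q = p ∨ t.mem q = true := by
  induction t with
  | leaf =>
    simp only [insert_leaf, mem_node, mem_leaf]
    cases h : Nat.beq q p
    · have : q ≠ p := by rintro rfl; simp at h
      simp [this]
    · simpa using Nat.eq_of_beq_eq_true h
  | node l k r ihl ihr =>
    have hble (a b : ℕ) : Nat.ble a b = decide (a ≤ b) := by
      rw [Bool.eq_iff_iff, Nat.ble_eq, decide_eq_true_iff]
    have hbeq (a b : ℕ) : Nat.beq a b = decide (a = b) := by
      rw [Bool.eq_iff_iff, Nat.beq_eq, decide_eq_true_iff]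
    simp only [insert_node, hble]
    by_cases hp : p ≤ k <;> by_cases hqk : q = k <;> by_cases hq : q ≤ k <;>
      simp [mem_node, hp, hq, hqk, hble, hbeq, ihl, ihr] <;> omega

end Tree

/-- A search through all states reachable from a list of states; `none` is a failure. -/
noncomputable def explore (next : ℕ → List (Option ℕ)) : ℕ → List (Option ℕ) → Tree → Bool
  | 0, _, _ => false
  | _ + 1, [], _ => true
  | _ + 1, none :: _, _ => false
  | n + 1, some p :: ps, t =>
    strict p fun p =>
      bif t.mem p then explore next n ps t else explore next n (next p ++ ps) (t.insert p)

/-- The hypothesis `ht` is the loop invariant: successors of visited states are visited or pending.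
When nothing is pending, the visited states form the invariant `P`. Exhausted fuel counts as
failure, so the value of `n` carries no meaning. -/
theorem exists_invariant_of_explore {next : ℕ → List (Option ℕ)} {n : ℕ}
    {todo : List (Option ℕ)} {t : Tree} (h : explore next n todo t = true)
    (ht : ∀ p, t.mem p = true → ∀ o ∈ next p, o ∈ todo ∨ ∃ q, o = some q ∧ t.mem q = true) :
    ∃ P : ℕ → Prop, (∀ p, t.mem p = true → P p) ∧ (∀ o ∈ todo, ∃ p, o = some p ∧ P p) ∧
      ∀ p, P p → ∀ o ∈ next p, ∃ q, o = some q ∧ P q := by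
  induction n generalizing todo t with
  | zero => simp [explore] at h
  | succ n ih =>
    rcases todo with _ | ⟨_ | p, ps⟩
    · exact ⟨fun p => t.mem p = true, fun _ => id, by simp, fun p hp o ho => by
        simpa using ht p hp o ho⟩
    · simp [explore] at h
    · simp only [explore, strict_eq] at h
      cases hp : t.mem p
      · rw [hp, cond_false] at h
        obtain ⟨P, h1, h2, h3⟩ := ih h (by
          intro q hq o ho
          rcases Tree.mem_insert.1 hq with rfl | hq
          · exact Or.inl (List.mem_append_left _ ho)
          · rcases ht q hq o ho with ho | ⟨r, rfl, hr⟩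
            · rcases List.mem_cons.1 ho with rfl | ho
              · exact Or.inr ⟨p, rfl, Tree.mem_insert.2 (Or.inl rfl)⟩
              · exact Or.inl (List.mem_append_right _ ho)
            · exact Or.inr ⟨r, rfl, Tree.mem_insert.2 (Or.inr hr)⟩)
        refine ⟨P, fun q hq => h1 q (Tree.mem_insert.2 (Or.inr hq)), ?_, h3⟩
        intro o ho
        rcases List.mem_cons.1 ho with rfl | ho
        · exact ⟨p, rfl, h1 p (Tree.mem_insert.2 (Or.inl rfl))⟩
        · exact h2 o (List.mem_append_right _ ho)
      · rw [hp, cond_true] at h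
        obtain ⟨P, h1, h2, h3⟩ := ih h (by
          intro q hq o ho
          rcases ht q hq o ho with ho | ho
          · rcases List.mem_cons.1 ho with rfl | ho
            · exact Or.inr ⟨p, rfl, hp⟩
            · exact Or.inl ho
          · exact Or.inr ho)
        refine ⟨P, h1, ?_, h3⟩
        intro o ho
        rcases List.mem_cons.1 ho with rfl | ho
        · exact ⟨p, rfl, h1 p hp⟩
        · exact h2 o ho

/-- A search that starts from the state `0`. -/
theorem exists_invariant_of_explore_zero {next : ℕ → List (Option ℕ)} {n : ℕ}
    (h : explore next n [some 0] .leaf = true) :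
    ∃ P : ℕ → Prop, P 0 ∧ ∀ p, P p → ∀ o ∈ next p, ∃ q, o = some q ∧ P q := by
  obtain ⟨P, -, h2, h3⟩ := exists_invariant_of_explore h (by simp)
  exact ⟨P, by simpa using h2, h3⟩

namespace Machine

/-! ### Comparison of machines -/

/-- A machine whose states are summaries together with numbers that evolve by `δ`. -/
def ofStep (δ : ℕ → ℕ → Option ℕ) (ok : ℕ → Bool) : Machine where
  step s a :=
    (δ (Nat.div s 128) a).bind fun q =>
      some (Nat.add (extendHead (Nat.mod s 128) a) (Nat.mul 128 q))
  ok s := ok (Nat.div s 128)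

theorem ofStep_read {δ : ℕ → ℕ → Option ℕ} {ok : ℕ → Bool} {w : List Symb} {s : ℕ}
    (h : (ofStep δ ok).read w = some s) :
    s % 128 = headCode (runs w) ∧
      w.foldr (fun a q => q.bind fun q => δ q a.digit) (some 0) = some (s / 128) := by
  induction w generalizing s with
  | nil =>
    obtain rfl : 0 = s := by simpa [read] using h
    exact ⟨rfl, rfl⟩
  | cons a w ih =>
    obtain ⟨t, ht, hs⟩ := Option.bind_eq_some_iff.1 h
    obtain ⟨ih1, ih2⟩ := ih ht
    have hlt := headCode_lt (runs (a :: w))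
    rw [headCode_runs_cons, ← ih1] at hlt ⊢
    simp only [ofStep, natMod_eq, natDiv_eq, natAdd_eq, natMul_eq, Option.bind_eq_some_iff,
      Option.some.injEq] at hs
    obtain ⟨q, hq, rfl⟩ := hs
    rw [List.foldr_cons, ih2]
    refine ⟨by omega, ?_⟩
    rw [Option.bind_some, hq]
    congr 1
    omega

theorem headed_ofStep {δ : ℕ → ℕ → Option ℕ} {ok : ℕ → Bool} : (ofStep δ ok).Headed :=
  fun _ _ h => (ofStep_read h).1

/-- The transition function of the automaton whose entry for the state `q` and the digit `a`
is the byte number `4 * q + a - 1` of `table`; a zero byte means that there is no transition. -/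
def byteStep (table q a : ℕ) : Option ℕ :=
  strict (Nat.mod (Nat.div table (256 ^ (4 * q + a - 1))) 256) fun r => bif Nat.beq r 0 then none else some r

/-- The automaton with the given transition table; `final` has the bits of the final states. -/
def automaton (table final : ℕ) : Machine :=
  ofStep (byteStep table) fun q => Nat.beq (final / 2 ^ q % 2) 1

/-- The transitions of the product of an automaton and a machine `N`, with a failure if a final
state of the automaton meets a bad state of `N`, or if `N` is stuck. -/
def productNext (table final : ℕ) (N : Machine) (p : ℕ) : List (Option ℕ) :=
  strict (p % 256) fun q => strict (p / 256) fun s =>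
    bif Nat.beq (final / 2 ^ q % 2) 1 && !N.ok s then [none]
    else [1, 2, 3, 4].flatMap fun a =>
      match byteStep table q a with
      | none => []
      | some r => [(N.step s a).map fun s' => r + 256 * s']

theorem mem_digits (a : Symb) : a.digit ∈ [1, 2, 3, 4] := by cases a <;> decide

theorem byteStep_lt {table q a r : ℕ} (h : byteStep table q a = some r) : r < 256 := by
  simp only [byteStep, strict_eq, natMod_eq, natDiv_eq] at h
  cases hr : Nat.beq (table / 256 ^ (4 * q + a - 1) % 256) 0
  · rw [hr] at h
    simp at h
    omega
  · simp [hr] at h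

/-- Inclusion of languages by the product construction. The pair of states is coded as `q + 256 *
s`, which can be decoded because table entries are bytes. -/
theorem accepts_of_explore_product {table final n : ℕ} {N : Machine}
    (h : explore (productNext table final N) n [some 0] .leaf = true) {w : List Symb}
    (hw : (automaton table final).Accepts w) : N.Accepts w := by
  obtain ⟨P, h0, hP⟩ := exists_invariant_of_explore_zero h
  have key : ∀ (w : List Symb) (q : ℕ),
      w.foldr (fun a q => q.bind fun q => byteStep table q a.digit) (some 0) = some q →
        q < 256 ∧ ∃ s, N.read w = some s ∧ P (q + 256 * s) := by
    intro w
    induction w with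
    | nil =>
      rintro q ⟨⟩
      exact ⟨by omega, 0, rfl, h0⟩
    | cons a w ih =>
      intro q hq
      rw [List.foldr_cons, Option.bind_eq_some_iff] at hq
      obtain ⟨r, hr, hq⟩ := hq
      obtain ⟨hlt, s, hs, hPs⟩ := ih r hr
      refine ⟨byteStep_lt hq, ?_⟩
      have hnext := hP _ hPs
      rw [productNext, strict_eq, strict_eq, show (r + 256 * s) % 256 = r by omega,
        show (r + 256 * s) / 256 = s by omega] at hnext
      cases hc : (Nat.beq (final / 2 ^ r % 2) 1 && !N.ok s)
      · rw [hc, cond_false] at hnext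
        obtain ⟨t, ht, hPt⟩ := hnext ((N.step s a.digit).map fun s => q + 256 * s)
          (List.mem_flatMap.2 ⟨a.digit, mem_digits a, by simp [hq]⟩)
        obtain ⟨s', hs', rfl⟩ := Option.map_eq_some_iff.1 ht
        exact ⟨s', by simp [read, hs, hs'], hPt⟩
      · simp [hc] at hnext
  obtain ⟨t, ht, hok⟩ := hw
  obtain ⟨hlt, s, hs, hPs⟩ := key w _ (ofStep_read ht).2
  have hnext := hP _ hPs
  change Nat.beq (final / 2 ^ (t / 128) % 2) 1 = true at hok
  generalize t / 128 = r at *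
  refine ⟨s, hs, ?_⟩
  by_contra hbad
  rw [Bool.not_eq_true] at hbad
  simp only [productNext, strict_eq, show (r + 256 * s) % 256 = r by omega,
    show (r + 256 * s) / 256 = s by omega, hok, hbad] at hnext
  simp at hnext

/-- The transitions of a machine that reads a word without four consecutive equal symbols, with a
fresh start at each cut. -/
def cutNext (N : Machine) (s : ℕ) : List (Option ℕ) :=
  -- State `0`, where nothing has been read, need not be good.
  bif Nat.beq s 0 || N.ok s then
    [1, 2, 3, 4].flatMap fun a =>
      -- A fourth equal symbol cannot occur in `W`. The restriction to `W` enters the proof only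
      -- here.
      bif Nat.beq (s % 8) a && Nat.beq (s / 8 % 8) 3 then [] else [N.cutStep s a]
  else [none]

theorem replicate_prefix_of_runs {x : List Symb} {k : ℕ} {a : Symb} {rs : List (ℕ × Symb)}
    (h : runs x = (k, a) :: rs) : List.replicate k a <+: x := by
  induction x generalizing k a rs with
  | nil => simp at h
  | cons b x ih =>
    rcases hr : runs x with _ | ⟨⟨m, c⟩, t⟩
    · rw [runs_cons_of_nil hr] at h
      simp only [List.cons.injEq, Prod.mk.injEq] at h
      obtain ⟨⟨rfl, rfl⟩, -⟩ := h
      simp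
    · by_cases hbc : b = c
      · subst hbc
        rw [runs_cons_same hr] at h
        simp only [List.cons.injEq, Prod.mk.injEq] at h
        obtain ⟨⟨rfl, rfl⟩, -⟩ := h
        simpa [List.replicate_succ] using ih hr
      · rw [runs_cons_diff hr hbc] at h
        simp only [List.cons.injEq, Prod.mk.injEq] at h
        obtain ⟨⟨rfl, rfl⟩, -⟩ := h
        simp

theorem accepts_of_explore_cut {n : ℕ} {N : Machine} (hN : N.Headed)
    (h : explore N.cutNext n [some 0] .leaf = true) {x : List Symb} (hx : x ∈ WDayOne) :
    ∀ u ∈ split x, N.Accepts u := by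
  obtain ⟨P, h0, hP⟩ := exists_invariant_of_explore_zero h
  have hok : ∀ s, P s → s = 0 ∨ N.ok s = true := by
    intro s hs
    have := hP s hs
    rw [cutNext] at this
    cases hc : (Nat.beq s 0 || N.ok s)
    · simp [hc] at this
    · simpa using hc
  have key : ∃ s, N.cutRead x = some s ∧ P s := by
    induction x with
    | nil => exact ⟨0, rfl, h0⟩
    | cons a x ih =>
      obtain ⟨s, hs, hPs⟩ := ih fun b hb => hx b (hb.trans (List.suffix_cons a x).isInfix)
      have hnext := hP s hPs
      have hc : (Nat.beq s 0 || N.ok s) = true := by simpa using hok s hPs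
      rw [cutNext, hc, cond_true] at hnext
      obtain ⟨t, ht, hPt⟩ := hnext (N.cutStep s a.digit) (by
        refine List.mem_flatMap.2 ⟨a.digit, mem_digits a, ?_⟩
        cases hb : (Nat.beq (s % 8) a.digit && Nat.beq (s / 8 % 8) 3)
        · simp
        · exfalso
          simp only [Bool.and_eq_true, Nat.beq_eq] at hb
          obtain ⟨rfl, rfl⟩ | ⟨v, vs, hv, hr, -⟩ := split_of_cutRead hN hs
          · simp at hb
          · have hh := hN v s hr
            have hlast := (separated_split x).2
            rw [hv, List.flatten_cons] at hlast
            rcases hrv : runs v with _ | ⟨⟨k, b⟩, rs⟩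
            · rw [hrv] at hh
              have := a.digit_pos
              simp [headCode] at hh
              omega
            · rw [hrv] at hh
              have h1 := headCode_mod_eight (k := k) (a := b) (rs := rs)
              have h2 := headCode_div_eight_mod_eight (k := k) (a := b) (rs := rs)
              rw [← hh] at h1 h2
              obtain rfl : a = b := Symb.digit_injective (by omega)
              obtain rfl : k = 3 := by omega
              have h3 := replicate_prefix_of_runs hrv
              refine hx a (List.IsPrefix.isInfix ?_)
              rw [List.replicate_succ, List.cons_prefix_cons, ← hlast]
              exact ⟨rfl, h3.trans (List.prefix_append _ _)⟩)
      exact ⟨t, by simp [cutRead, hs, ht], hPt⟩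
  obtain ⟨s, hs, hPs⟩ := key
  refine accepts_of_cutRead hN hs ?_
  rcases split_of_cutRead hN hs with ⟨rfl, -⟩ | ⟨v, vs, hv, hr, -⟩
  · exact Or.inl rfl
  · refine Or.inr ((hok s hPs).resolve_left ?_)
    -- The summary of a nonempty word has a nonzero digit, so `0` is not the state of `v`.
    rintro rfl
    have hh := hN v 0 hr
    have hvne : v ≠ [] := by
      have := (separated_split x).1
      rw [hv] at this
      exact this.1
    rcases hrv : runs v with _ | ⟨⟨k, b⟩, rs⟩
    · exact hvne (runs_eq_nil.1 hrv)
    · rw [hrv] at hh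
      have h1 := headCode_mod_eight (k := k) (a := b) (rs := rs)
      have := b.digit_pos
      omega

/-- The number with the digits of a word, read backwards in base five. -/
def wordCode (w : List Symb) : ℕ :=
  w.foldr (fun a c => 5 * c + a.digit) 0

/-- All digits lie between one and four; as none is zero, the code determines the length too. -/
theorem wordCode_injective : Function.Injective wordCode := by
  intro v w h
  induction v generalizing w with
  | nil =>
    cases w with
    | nil => rfl
    | cons b w =>
      have := b.digit_pos
      simp [wordCode] at h
      omega
  | cons a v ih =>
    have hlt (a : Symb) : a.digit < 5 := by cases a <;> decide
    cases w with
    | nil =>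
      have := a.digit_pos
      simp [wordCode] at h
      omega
    | cons b w =>
      change 5 * wordCode v + a.digit = 5 * wordCode w + b.digit at h
      have ha := hlt a
      have hb := hlt b
      rw [ih (show wordCode v = wordCode w by omega),
        Symb.digit_injective (show a.digit = b.digit by omega)]

/-- The machine that accepts the words whose codes are in a given tree. -/
noncomputable def ofTree (t : Tree) : Machine :=
  ofStep (fun q a => some (5 * q + a)) fun q => t.mem q

theorem mem_of_accepts_ofTree {t : Tree} {w : List Symb} (h : (ofTree t).Accepts w) :
    t.mem (wordCode w) = true := by
  obtain ⟨s, hs, hok⟩ := h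
  have h2 := (ofStep_read hs).2
  have (w : List Symb) : w.foldr (fun a (q : Option ℕ) => q.bind fun q => some (5 * q + a.digit))
      (some 0) = some (wordCode w) := by
    induction w with
    | nil => rfl
    | cons a w ih => rw [List.foldr_cons, ih]; rfl
  rw [this, Option.some.injEq] at h2
  rw [h2]
  exact hok

end Machine

/-- The tree of the codes of some words. -/
noncomputable def codeTree (ws : List (List Symb)) : Tree :=
  ws.foldr (fun w t => t.insert (Machine.wordCode w)) .leaf

theorem mem_codeTree {ws : List (List Symb)} {w : List Symb} :
    (codeTree ws).mem (Machine.wordCode w) = true ↔ w ∈ ws := by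
  induction ws with
  | nil => simp [codeTree]
  | cons v ws ih =>
    rw [codeTree, List.foldr_cons, Tree.mem_insert, Machine.wordCode_injective.eq_iff,
      List.mem_cons]
    exact or_congr_right ih

/-! ### Automata for the early days -/

/-- The transitions of an automaton for the factors of words that have been derived once. -/
def tableOne : ℕ :=
  0x11001d0000101900001e1800111e00000d220c0014061f0003130100172112001721200014001f0014060e00001e1d000d1c0800140f05001a0000001b001d0000001800170012000d130c00031c0c001b0000001a00190011001800171615001400050000130000070005000b00120011100000070f0e000d000c000b000a000309080007060504030201

/-- The final states of the automaton `tableOne`. -/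
def finalOne : ℕ :=
  0x792fefffe

/-- The transitions of an automaton for the factors of words that have been derived twice. -/
def tableTwo : ℕ :=
  0x36002600003a000041401d002f060e00216c2000225730002f2e1d000c003000215930002f006b005c2e1d001b006600103e2d000044510021613000476a290038001f001b0069004768000067006600652e4b00006463000c0037003459620021611d0007066000320039001b001a00325f0000005f3700005e35004754000000005d005c2e2d0021155b002f005a000050290022003c0021591d00004f1f00450039001b504200253e2d00380016001b44580022573c0056551d001254000000000000031553000052510000504d00004f4e0000004d00220013002f2e3c000c004c00072e4b0000001f00004a490000004800380000004746000045000000324443001b004200414030003f000000253e3c00223113002f063d000c003c000a3b20002f062900003a39003800370036001a0000003500341533003200000022311f00220030002f2e2d00002c2b00002a2800250f2900000028002700260025240e000000230022001f00211520000c001f000a1e1d001c0000001b001a0000191800000017000c00160000150000070014000c00130012110000100f0e0000000d000c000b000a09080007060504030201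

/-- The final states of the automaton `tableTwo`. -/
def finalTwo : ℕ :=
  0x1c2d1c4d9a9238dfbe37aa7dffee

/-- The transitions of an automaton for the factors of words that have been derived three times. -/
def tableThree : ℕ :=
  0xb40062005c38de00008cdd0048dc620000db3000b400a5000000da002200260000d9b10012670000b48900002200d800d738ad004f8930007f00620000d6000000d5660039380e00003600007b8c3a003964d400d387d200680062005900ca000000d1007b00d0003000cf001d00ce007b00cd0000cc9c0020cb1e00b47c0000b400ca0025c91e005f00a1003c82c80088c72300b40000005f00c6007b8cc5004f8900000061c4000000800000c3c20000b530007b0069000000c1004fc0300022008d006f000000396dbf00396d370088be46003938ad0032bd300022008000bcbb81000062b60068ba00003938b900b8b781000000b60000b5130059000000b400000068b30000b2000000a000a90083b1b000000030000000af00ae38ad007f00ac000000ab0000aa0000681100007b00a900007c30000000a80022002c00a7a60e00000099005900a5007b003f0053a43000838b8100220035000000a300009a69004fa23000128900005f00a100a0003f006800000000006900000026000044560039389f0088876200000013002b529e00009d9c00259b1e00009a99000c0098008f385b003c829700889695003000940053933000833b8b000000210025921e0068700000000091000c0090008f648e005356300000008d00008c8b004f6e000000008a00125a00006f8900007f0000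00888713004f6e3000001b86000000850000628400220013006f00620083828100001b80007f007e0000007d00007c00007b007a0000007900510000004f780000001b7700762475000000300025741e000073720000007100127000006f6e0000306d300022006c006b176a0016006900004d2100686700003038300000006600004d6500396463000000620000614300000060005f005e0041005d005c385b00220000004f5a000059000000005857000000560025555400535230005100300020501e00000000004f4e3000004d4c00394b4a00000049001400000048474600450000000034430000443000000043000c0042004100400016003f0000003e00000033000c003d003c3b3a0012000000001b21003938370000363500003433003231300000002f002e002d0000002c002b2a2900001b280000002700000026002524230022002100201f1e001d00000000001c00001b1a00000019000c00180000170000160015001400130012110000100f0e0000000d000c000b000a09080007060504030201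

/-- The final states of the automaton `tableThree`. -/
def finalThree : ℕ :=
  0x1ad1058111060827161a11108649d3c5918bd4432a51e6b49cd4fee

/-- Words that may remain, besides the elements, among the factors of a word after eleven
derivations. -/
def isotopes : List (List Symb) :=
  [word 31133, word 111321, word 123222, word 3123222, word 11121332, word 31131211,
   word 123222114, word 321122112, word 1113212221, word 1311121332, word 3113111221,
   word 11131221132, word 11133112112, word 13211311222, word 13221131112, word 31121123222,
   word 32211322112, word 111213322114, word 111312211332, word 131221222112, word 132113111221,
   word 132113312211, word 311312113211, word 1232221133112, word 3122113222112,
   word 11132221133112, word 13211221121332, word 13211311222113, word 13211322211312,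
   word 13222113222112, word 31121123222114, word 31131122211312, word 322113221122112,
   word 1113112211322112, word 1113122113312211, word 1113122113322112, word 1113322113322112,
   word 1311222113322112, word 11131221222112112, word 31221132221222112, word 132112211213322114,
   word 132113111221131221, word 132221132221222112, word 311321222113222112,
   word 1312212221121123222, word 11131122113221122112, word 11131221133122211332,
   word 11131221133211322112, word 11131221133221131112, word 11133221133211322112,
   word 13112221133211322112, word 31131122113221122112, word 31131221133221131112,
   word 31133221133122211332, word 31221132221222112112, word 111312211311122113222,
   word 111312212221121123222, word 111322211311122113222, word 132221132221222112112,
   word 1113222113111221131221, word 1312212221121123222112, word 1312212221121123222113,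
   word 1321131211322113322112, word 3113112221133122211332, word 3113212221132221222112,
   word 32211322112211213322112, word 32211322112211213322113, word 32211322112211213322114,
   word 111311221132211221121332, word 111312211331222113112211, word 111312211332113221122112,
   word 111312212221121123222114, word 111332211332113221122112, word 131122211332113221122112,
   word 132113212221132221222112, word 311311221132211221121332, word 311332211331222113112211,
   word 3113212221132221222112112, word 13211312113221133211322112,
   word 132113212221132221222112112, word 1113112211322112211213322112,
   word 1113112211322112211213322113, word 1322211322212221121123222112,
   word 1322211322212221121123222113, word 1322211322212221121123222114,
   word 3113112211322112211213322114, word 3113122113322113111221131221,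
   word 111312211312113221133211322112, word 132113121132211332113221122112,
   word 11131221133211322112211213322112, word 11131221133211322112211213322113,
   word 11131221133211322112211213322114, word 11133221133211322112211213322112,
   word 11133221133211322112211213322113, word 11133221133211322112211213322114,
   word 31132122211322212221121123222112, word 31132122211322212221121123222113,
   word 31132122211322212221121123222114, word 1113122113121132211332113221122112,
   word 1321132122211322212221121123222114, word 13211312113221133211322112211213322112,
   word 13211312113221133211322112211213322113, word 13211312113221133211322112211213322114,
   word 111312211312113221133211322112211213322114]

/-! ### A fast derivation -/

/-- Equality of symbols. -/
def Symb.same : Symb → Symb → Bool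
  | .one, .one => true
  | .two, .two => true
  | .three, .three => true
  | .d, .d => true
  | _, _ => false

theorem Symb.same_iff {a b : Symb} : a.same b = true ↔ a = b := by
  cases a <;> cases b <;> simp [Symb.same]

/-- The symbol for a count that is larger by one. -/
def Symb.succ : Symb → Symb
  | .one => .two
  | .two => .three
  | _ => .d

/-- The derivation, computed without counting; written with the recursor for the sake of kernel
computations. -/
noncomputable def derive (x : List Symb) : List Symb :=
  List.rec [] (fun a _ y =>
    match y with
    | k :: b :: y => bif a.same b then k.succ :: b :: y else .one :: a :: k :: b :: y
    | _ => [.one, a]) x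

theorem derive_cons (a : Symb) (x : List Symb) : derive (a :: x) =
    match derive x with
    | k :: b :: y => bif a.same b then k.succ :: b :: y else .one :: a :: k :: b :: y
    | _ => [.one, a] := rfl

theorem derive_eq (x : List Symb) : derive x = C x := by
  induction x with
  | nil => rfl
  | cons a x ih =>
    rw [derive_cons, ih, C_eq_say, C_eq_say]
    rcases h : runs x with _ | ⟨⟨n, b⟩, r⟩
    · rw [runs_cons_of_nil h]; rfl
    · have hn : (countSym n).succ = countSym (n + 1) := by
        have := runs_pos h
        rcases n with _ | _ | _ | _ | n
        · omega
        all_goals rfl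
      by_cases hab : a = b
      · subst hab
        rw [runs_cons_same h]
        simp [Symb.same_iff.2 rfl, hn]
      · have : a.same b = false := by rwa [Bool.eq_false_iff, Ne, Symb.same_iff]
        rw [runs_cons_diff h hab]
        simp [this]

/-- Whether the first word is a prefix of the second one. -/
def isPrefix : List Symb → List Symb → Bool
  | [], _ => true
  | _ :: _, [] => false
  | a :: x, b :: y => bif a.same b then isPrefix x y else false

theorem isPrefix_iff {x y : List Symb} : isPrefix x y = true ↔ x <+: y := by
  induction x generalizing y with
  | nil => simp [isPrefix]
  | cons a x ih =>
    cases y with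
    | nil => simp [isPrefix]
    | cons b y =>
      rw [isPrefix, List.cons_prefix_cons, ← ih, ← Symb.same_iff]
      cases a.same b <;> simp

/-! ### Atoms -/

/-- Within `n` derivations of `u` and `e`, the former is not a prefix of the latter. -/
noncomputable def breaksWithin : ℕ → List Symb → List Symb → Bool
  | 0, _, _ => false
  | n + 1, u, e => bif isPrefix u e then breaksWithin n (derive u) (derive e) else true

theorem exists_not_prefix_of_breaksWithin {n : ℕ} {u e : List Symb}
    (h : breaksWithin n u e = true) : ∃ k, ¬ C^[k] u <+: C^[k] e := by
  induction n generalizing u e with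
  | zero => simp [breaksWithin] at h
  | succ n ih =>
    rw [breaksWithin] at h
    cases hp : isPrefix u e
    · refine ⟨0, ?_⟩
      rw [Function.iterate_zero, id, id, ← isPrefix_iff, hp]
      simp
    · rw [hp, cond_true, derive_eq, derive_eq] at h
      obtain ⟨k, hk⟩ := ih h
      exact ⟨k + 1, hk⟩

/-- The first nonempty factor yields a prefix of every derivation of `e`, so it equals `e`;
comparing lengths before any derivation, the later factors are empty. -/
theorem SplitsInto.eq_of_mem {e : List Symb}
    (he : ∀ u, u ≠ [] → u ≠ e → ∃ k, ¬ C^[k] u <+: C^[k] e) {us : List (List Symb)}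
    (h : SplitsInto e us) {y : List Symb} (hy : y ∈ us) (hne : y ≠ []) : y = e := by
  induction us with
  | nil => simp at hy
  | cons u us ih =>
    by_cases hu : u = []
    · subst hu
      refine ih (fun n => ?_) ?_
      · simpa using h n
      · exact (List.mem_cons.1 hy).resolve_left hne
    · have hue : u = e := by
        by_contra hue
        obtain ⟨k, hk⟩ := he u hu hue
        refine hk ?_
        rw [h k, List.map_cons, List.flatten_cons]
        exact List.prefix_append _ _
      subst hue
      have h0 := h 0
      simp only [Function.iterate_zero, List.map_id_fun, id_eq, List.flatten_cons,
        List.self_eq_append_right, List.flatten_eq_nil_iff] at h0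
      exact (List.mem_cons.1 hy).resolve_right fun hy => hne (h0 y hy)

theorem isAtom_of_breaksWithin {e : List Symb} {n : ℕ} (hne : e ≠ [])
    (h : ∀ i < e.length, i = 0 ∨ breaksWithin n (e.take i) e = true) : IsAtom e := by
  refine ⟨hne, e, ⟨hne, [e], fun n => by simp, by simp⟩, ?_⟩
  rintro y ⟨hy, us, hus, hmem⟩
  refine hus.eq_of_mem (fun u hu hue => ?_) hmem hy
  -- Words that are not prefixes of `e` fail before any derivation, so only the finitely many proper
  -- prefixes need a computation.
  by_cases hp : u <+: e
  · have hlen : u.length < e.length :=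
      lt_of_le_of_ne hp.length_le fun h => hue (hp.eq_of_length h)
    rcases h u.length hlen with h0 | h
    · exact absurd (List.length_eq_zero_iff.1 h0) hu
    · rw [← List.prefix_iff_eq_take.1 hp] at h
      exact exists_not_prefix_of_breaksWithin h
  · exact ⟨0, hp⟩

theorem isAtom_elements : ∀ e ∈ elements, IsAtom e := by
  -- Ten comparisons, that is at most nine derivations, expose every nonempty proper prefix of every
  -- element.
  have key : (commonElements ++ transuranicElements).all (fun e => !e.isEmpty &&
      (List.range e.length).all fun i => Nat.beq i 0 || breaksWithin 10 (e.take i) e) = true := by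
    decide +kernel
  intro e he
  have h := List.all_eq_true.1 key e (List.mem_toFinset.1 he)
  rw [Bool.and_eq_true, List.all_eq_true] at h
  refine isAtom_of_breaksWithin (n := 10) (by simpa using h.1) fun i hi => ?_
  simpa using h.2 i (List.mem_range.2 hi)

/-! ### The decay of all words -/

/-- The tree of the codes of the elements. -/
noncomputable def elementTree : Tree :=
  codeTree (commonElements ++ transuranicElements)

theorem mem_elementTree {w : List Symb} :
    elementTree.mem (Machine.wordCode w) = true ↔ w ∈ elements := by
  rw [elementTree, mem_codeTree, elements, List.mem_toFinset]

/-- All factors of a word are elements after at most `n` derivations. -/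
noncomputable def decaysWithin : ℕ → List Symb → Bool
  | 0, w => elementTree.mem (Machine.wordCode w)
  | n + 1, w => elementTree.mem (Machine.wordCode w) || (split (derive w)).all (decaysWithin n)

theorem split_C_elements {e : List Symb} (he : e ∈ elements) :
    ∀ u ∈ split (C e), u ∈ elements := by
  have key : (commonElements ++ transuranicElements).all (fun e =>
      (split (C e)).all fun u => elementTree.mem (Machine.wordCode u)) = true := by
    decide +kernel
  intro u hu
  exact mem_elementTree.1
    (List.all_eq_true.1 (List.all_eq_true.1 key e (List.mem_toFinset.1 he)) u hu)

theorem decay_elements {n : ℕ} {e : List Symb} (he : e ∈ elements) :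
    ∀ u ∈ decay n e, u ∈ elements := by
  induction n generalizing e with
  | zero => simpa [decay] using he
  | succ n ih =>
    intro u hu
    obtain ⟨v, hv, hu⟩ := List.mem_flatMap.1 hu
    exact ih (split_C_elements he v hv) u hu

/-- Once a factor is an element its further decay stays among the elements, so stopping early is
harmless and the bound may be enlarged. -/
theorem mem_elements_of_decaysWithin {n m : ℕ} {w : List Symb} (h : decaysWithin n w = true)
    (hnm : n ≤ m) : ∀ u ∈ decay m w, u ∈ elements := by
  induction n generalizing m w with
  | zero => exact decay_elements (mem_elementTree.1 h)
  | succ n ih =>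
    rw [decaysWithin, Bool.or_eq_true, derive_eq] at h
    rcases h with h | h
    · exact decay_elements (mem_elementTree.1 h)
    · obtain ⟨m, rfl⟩ : ∃ l, m = l + 1 := ⟨m - 1, by omega⟩
      intro u hu
      obtain ⟨v, hv, hu⟩ := List.mem_flatMap.1 hu
      exact ih (List.all_eq_true.1 h v hv) (by omega) u hu

/-- The bound is `13 = 24 - 11`, the number of derivations left after the first eleven. -/
theorem isotopes_decay : ∀ w ∈ isotopes, decaysWithin 13 w = true :=
  List.all_eq_true.1 (by decide +kernel)

open Machine in
/-- The factors of a word after eleven derivations are elements or isotopes. -/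
theorem mem_of_mem_decay_eleven {x v w : List Symb} (hx : x ∈ WDayOne) (hv : v ∈ split x)
    (hw : w ∈ decay 11 v) : w ∈ commonElements ++ transuranicElements ++ isotopes := by
  have h₁ : explore (automaton tableOne finalOne).lift.cutNext 1000 [some 0] .leaf = true := by
    decide +kernel
  have h₂ : explore (productNext tableOne finalOne (automaton tableTwo finalTwo).lift)
      2000 [some 0] .leaf = true := by
    decide +kernel
  have h₃ : explore (productNext tableTwo finalTwo (automaton tableThree finalThree).lift)
      2000 [some 0] .leaf = true := by
    decide +kernel
  -- The machine of a tree has infinitely many states, but success of the search means that only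
  -- finitely many are reachable: from the third derivation on, eight further ones leave factors
  -- from a finite list.
  have h₄ : explore (productNext tableThree finalThree
      (lift^[8] (ofTree (codeTree (commonElements ++ transuranicElements ++ isotopes)))))
      4000 [some 0] .leaf = true := by
    decide +kernel
  rw [show 11 = 1 + (1 + (1 + 8)) from rfl, mem_decay_add] at hw
  obtain ⟨w₁, hw₁, hw⟩ := hw
  obtain ⟨w₂, hw₂, hw⟩ := mem_decay_add.1 hw
  obtain ⟨w₃, hw₃, hw⟩ := mem_decay_add.1 hw
  have a₁ := accepts_of_mem_decay (n := 1) headed_ofStep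
    (accepts_of_explore_cut headed_lift h₁ hx v hv) w₁ hw₁
  have a₂ := accepts_of_mem_decay (n := 1) headed_ofStep
    (accepts_of_explore_product h₂ a₁) w₂ hw₂
  have a₃ := accepts_of_mem_decay (n := 1) headed_ofStep
    (accepts_of_explore_product h₃ a₂) w₃ hw₃
  exact mem_codeTree.1 (mem_of_accepts_ofTree
    (accepts_of_mem_decay headed_ofStep (accepts_of_explore_product h₄ a₃) w hw))

theorem mem_elements_of_mem_decay {x v u : List Symb} {n : ℕ} (hx : x ∈ WDayOne) (hn : 24 ≤ n)
    (hv : v ∈ split x) (hu : u ∈ decay n v) : u ∈ elements := by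
  obtain ⟨m, rfl⟩ : ∃ m, n = 11 + m := ⟨n - 11, by omega⟩
  obtain ⟨w, hw, hu⟩ := mem_decay_add.1 hu
  rcases List.mem_append.1 (mem_of_mem_decay_eleven hx hv hw) with h | h
  · exact decay_elements (List.mem_toFinset.2 h) u hu
  · exact mem_elements_of_decaysWithin (isotopes_decay w h) (by omega) u hu

end Audioactive

open Audioactive in
theorem mainTheorem1 :
    elements.card = 94 ∧ (∀ e ∈ elements, IsAtom e) ∧
      ∀ x ∈ WDayOne, ∀ n : ℕ, 24 ≤ n →
        ∃ us : List (List Symb),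
          SplitsInto (C^[n] x) us ∧ ∀ u ∈ us, IsAtom u ∧ u ∈ elements := by
  refine ⟨by decide +kernel, isAtom_elements, fun x hx n hn => ?_⟩
  refine ⟨(split x).flatMap (decay n),
    (splitsInto_split x).flatMap fun u _ => splitsInto_decay n u, fun u hu => ?_⟩
  obtain ⟨v, hv, hu⟩ := List.mem_flatMap.1 hu
  have hmem := mem_elements_of_mem_decay hx hn hv hu
  exact ⟨isAtom_elements u hmem, hmem⟩
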